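/- Let $n,k$ be integers with $1\le k<n$ and let $0<R\le\infty$. For a function $f$ and a real matrix $A=(a_{ij})$ with entries in its domain, write $f[A]=(f(a_{ij}))$; let $\mathbf 1_{n\times n}$ be the $n\times n$ matrix with all entries equal to $1$. (1) Let $I=[0,R)$ or $I=(-R,R)$, and let $f\in C^k(I)$ be real-valued (with one-sided derivatives at $0$ when $I=[0,R)$). Then the following are equivalent: (a) for all $a\in I$ and all $u\in\mathbb R^n$ such that $a+u_iu_j\in I$ for all $i,j$, the symmetric matrix $f[a\mathbf 1_{n\times n}+uu^T]$ has rank at most $k$; (b) $f$ coincides on $I$ with a real polynomial of degree at most $k-1$ (the zero polynomial being allowed). (2) Let $I=[0,R)$ and $f:I\to\mathbb R$, and suppose that $f\in C^k(I)$ or that $k\le n-3$ (in the latter case no regularity of $f$ is assumed). Then the following are equivalent: (a) for all $a\in[0,R)$ and all $u\in\mathbb R^n$ such that $a+u_iu_j\in I$ for all $i,j$, the matrix $f[a\mathbf 1_{n\times n}+uu^T]$ is positive semidefinite of rank at most $k$; (b) $f$ coincides on $I$ with a polynomial of degree at most $k-1$ with nonnegative coefficients. -/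

import Mathlib

/-- The interval `[0, R)` of reals, where `R` may be `∞`. -/
def rightInterval (R : EReal) : Set ℝ := {x : ℝ | 0 ≤ x ∧ (x : EReal) < R}

/-- The interval `(-R, R)` of reals, where `R` may be `∞`. -/
def symmInterval (R : EReal) : Set ℝ := {x : ℝ | -R < (x : EReal) ∧ (x : EReal) < R}

/-- The real symmetric `n × n` matrices of rank at most `k`. -/
def symmRankLE (n k : ℕ) : Set (Matrix (Fin n) (Fin n) ℝ) :=
  {A | A.IsSymm ∧ A.rank ≤ k}

/-- The real symmetric positive semidefinite `n × n` matrices of rank at most `k`. -/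
def psdRankLE (n k : ℕ) : Set (Matrix (Fin n) (Fin n) ℝ) :=
  {A | A.PosSemidef ∧ A.rank ≤ k}

/-- The matrix `a 𝟏 + u uᵀ`, where `𝟏` is the matrix with all entries equal to `1`. -/
def specialMatrix {n : ℕ} (a : ℝ) (u : Fin n → ℝ) : Matrix (Fin n) (Fin n) ℝ :=
  a • Matrix.of (fun _ _ => (1 : ℝ)) + Matrix.vecMulVec u u

theorem specialMatrix_apply {n : ℕ} (a : ℝ) (u : Fin n → ℝ) (i j : Fin n) :
    specialMatrix a u i j = a + u i * u j := by
  simp [specialMatrix, Matrix.vecMulVec_apply]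

/-! Let g(t) = f(a + t) have Taylor coefficients d_m, m ≤ k, and let V be the Vandermonde matrix of
0, …, k. The matrix g(s²ij) equals V diag(d_m s^{2m}) Vᵀ + o(s^{2k}); removing V and rescaling by
s^{-m} on both sides leaves a matrix tending to diag(d). Rank at most k makes the determinants
vanish, so ∏ d_m = 0: at each a some derivative of order at most k is zero. By continuity the k-th
then vanishes identically (`iteratedDeriv_eq_zero_of_forall_exists`), so f is a polynomial of degree
below k. Conversely, (xy)^m = x^m y^m factors the matrix through dimension k, with the Taylor
coefficients at a on the diagonal.

Without regularity, 2 × 2 positivity makes f monotone and 3 × 3 positivity makes it midpoint convex,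
hence continuous. On (0, b) the positive kernel f(xy) has zero Schur complement over a maximal
invertible minor (`exists_separated`), so f(xy) = ∑ f(x v_i) c_i(y). Averaging in x shows that the
c_i, and so f, gain a derivative (`contDiffOn_succ_of_separated`); iterating reduces to the smooth
case. -/

/-! ### Vanishing derivatives from singular matrices -/

open Filter Topology Asymptotics in
/-- If `g t = ∑ m ≤ k, d m * t ^ m + o(t ^ k)` and the matrices `g (s ^ 2 * i * j)` are singular
for small `s`, then some `d m` vanishes. -/
theorem exists_coeff_eq_zero_of_det_eq_zero {k : ℕ} {g : ℝ → ℝ} {d : Fin (k + 1) → ℝ}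
    (hg : (fun t => g t - ∑ m, d m * t ^ (m : ℕ)) =o[𝓝 0] fun t => t ^ k)
    (hdet : ∀ᶠ s in 𝓝[≠] (0 : ℝ),
      (Matrix.of fun i j : Fin (k + 1) => g (s ^ 2 * ((i : ℝ) * (j : ℝ)))).det = 0) :
    ∃ m, d m = 0 := by
  set e : ℝ → ℝ := fun t => g t - ∑ m, d m * t ^ (m : ℕ) with he
  set V : Matrix (Fin (k + 1)) (Fin (k + 1)) ℝ := Matrix.vandermonde fun i => (i : ℝ) with hV
  have hVdet : IsUnit V.det := by
    rw [isUnit_iff_ne_zero, hV, Matrix.det_vandermonde_ne_zero_iff]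
    intro i j hij
    exact Fin.ext (Nat.cast_injective (R := ℝ) hij)
  set W := V⁻¹ with hW
  have hWV : W * V = 1 := Matrix.nonsing_inv_mul V hVdet
  have hVW : V.transpose * W.transpose = 1 := by
    rw [← Matrix.transpose_mul, hWV, Matrix.transpose_one]
  let S : ℝ → Matrix (Fin (k + 1)) (Fin (k + 1)) ℝ :=
    fun s => Matrix.diagonal fun m => (s⁻¹) ^ (m : ℕ)
  let E : ℝ → Matrix (Fin (k + 1)) (Fin (k + 1)) ℝ :=
    fun s => Matrix.of fun i j => e (s ^ 2 * ((i : ℝ) * (j : ℝ)))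
  let B : ℝ → Matrix (Fin (k + 1)) (Fin (k + 1)) ℝ :=
    fun s => Matrix.diagonal d + S s * (W * E s * W.transpose) * S s
  have hB : ∀ s : ℝ, s ≠ 0 → B s = S s * (W * (Matrix.of fun i j : Fin (k + 1) =>
      g (s ^ 2 * ((i : ℝ) * (j : ℝ)))) * W.transpose) * S s := by
    intro s hs
    have hN : (Matrix.of fun i j : Fin (k + 1) => g (s ^ 2 * ((i : ℝ) * (j : ℝ)))) =
        V * Matrix.diagonal (fun m => d m * (s ^ 2) ^ (m : ℕ)) * V.transpose + E s := by
      ext i j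
      simp only [Matrix.of_apply, Matrix.add_apply, E, he]
      rw [Matrix.mul_apply]
      simp only [Matrix.mul_diagonal, Matrix.transpose_apply, hV, Matrix.vandermonde_apply]
      have hsum : ∑ m : Fin (k + 1), (i : ℝ) ^ (m : ℕ) * (d m * (s ^ 2) ^ (m : ℕ)) *
          (j : ℝ) ^ (m : ℕ) = ∑ m, d m * (s ^ 2 * ((i : ℝ) * (j : ℝ))) ^ (m : ℕ) := by
        refine Finset.sum_congr rfl fun m _ => ?_
        rw [mul_pow, mul_pow]
        ring
      rw [hsum]
      ring
    have hD : W * (V * Matrix.diagonal (fun m => d m * (s ^ 2) ^ (m : ℕ)) * V.transpose) *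
        W.transpose = Matrix.diagonal (fun m => d m * (s ^ 2) ^ (m : ℕ)) := by
      calc _ = (W * V) * Matrix.diagonal (fun m => d m * (s ^ 2) ^ (m : ℕ)) *
            (V.transpose * W.transpose) := by simp only [Matrix.mul_assoc]
        _ = _ := by rw [hWV, hVW, Matrix.one_mul, Matrix.mul_one]
    rw [hN, Matrix.mul_add, Matrix.add_mul, hD, Matrix.mul_add, Matrix.add_mul]
    simp only [B]
    congr 1
    simp only [S, Matrix.diagonal_mul_diagonal]
    congr 1
    ext m
    rw [inv_pow, ← pow_mul, mul_comm 2, pow_mul]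
    field_simp
  have hBdet : ∀ᶠ s in 𝓝[≠] (0 : ℝ), (B s).det = 0 := by
    filter_upwards [hdet, self_mem_nhdsWithin] with s hs hs0
    rw [hB s hs0]
    simp only [Matrix.det_mul, hs]
    ring
  have hE : ∀ i j m l : Fin (k + 1), Tendsto (fun s : ℝ => (s⁻¹) ^ (m : ℕ) * (s⁻¹) ^ (l : ℕ) *
      E s i j) (𝓝[≠] 0) (𝓝 0) := by
    intro i j m l
    have hc : Tendsto (fun s : ℝ => s ^ 2 * ((i : ℝ) * (j : ℝ))) (𝓝[≠] 0) (𝓝 0) := by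
      have : ContinuousAt (fun s : ℝ => s ^ 2 * ((i : ℝ) * (j : ℝ))) 0 := by fun_prop
      have h2 := this.tendsto
      simp only [ne_eq, OfNat.ofNat_ne_zero, not_false_eq_true, zero_pow, zero_mul] at h2
      exact h2.mono_left nhdsWithin_le_nhds
    have h1 := hg.comp_tendsto hc
    -- Since m, l ≤ k, the remainder o(s^{2k}) survives division by s^{m+l}.
    have h2 : (fun s : ℝ => (s ^ 2 * ((i : ℝ) * (j : ℝ))) ^ k) =O[𝓝[≠] 0]
        fun s => s ^ ((m : ℕ) + l) := by
      have h3 : (fun s : ℝ => s ^ (2 * k)) =O[𝓝[≠] 0] fun s => s ^ ((m : ℕ) + l) :=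
        IsBigO.of_bound 1 (by
          filter_upwards [nhdsWithin_le_nhds (Metric.ball_mem_nhds (0 : ℝ) one_pos)] with x hx
          rw [norm_pow, norm_pow, one_mul]
          exact pow_le_pow_of_le_one (norm_nonneg x) (mem_ball_zero_iff.mp hx).le
            (by have := m.is_lt; have := l.is_lt; omega))
      have h4 := h3.const_mul_left (((i : ℝ) * (j : ℝ)) ^ k)
      refine h4.congr_left fun s => ?_
      rw [mul_pow (s ^ 2), ← pow_mul]; ring
    have h3 := (h1.trans_isBigO h2).tendsto_div_nhds_zero
    refine h3.congr fun s => ?_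
    simp only [Function.comp, E, Matrix.of_apply, he, div_eq_mul_inv, pow_add, inv_pow, mul_inv]
    ring
  have hlim : Tendsto B (𝓝[≠] 0) (𝓝 (Matrix.diagonal d)) := by
    have h0 : Tendsto (fun s => S s * (W * E s * W.transpose) * S s) (𝓝[≠] 0) (𝓝 0) := by
      refine tendsto_pi_nhds.mpr fun m => tendsto_pi_nhds.mpr fun l => ?_
      have h1 : ∀ s, (S s * (W * E s * W.transpose) * S s) m l =
          ∑ j, ∑ i, W m i * W l j * ((s⁻¹) ^ (m : ℕ) * (s⁻¹) ^ (l : ℕ) * E s i j) := by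
        intro s
        simp only [S, Matrix.mul_diagonal, Matrix.diagonal_mul]
        rw [Matrix.mul_apply, Finset.mul_sum, Finset.sum_mul]
        refine Finset.sum_congr rfl fun j _ => ?_
        rw [Matrix.mul_apply, Finset.sum_mul, Finset.mul_sum, Finset.sum_mul]
        refine Finset.sum_congr rfl fun i _ => ?_
        rw [Matrix.transpose_apply]
        ring
      simp only [h1, Matrix.zero_apply]
      have h2 := tendsto_finsetSum (Finset.univ : Finset (Fin (k + 1))) fun j _ =>
        tendsto_finsetSum (Finset.univ : Finset (Fin (k + 1))) fun i _ =>
          (hE i j m l).const_mul (W m i * W l j)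
      simpa using h2
    simpa [B] using h0.const_add (Matrix.diagonal d)
  have hdetlim : Tendsto (fun s => (B s).det) (𝓝[≠] 0) (𝓝 (Matrix.diagonal d).det) :=
    ((Continuous.matrix_det continuous_id).tendsto (Matrix.diagonal d)).comp hlim
  have hz : (Matrix.diagonal d).det = 0 :=
    tendsto_nhds_unique hdetlim (tendsto_const_nhds.congr' (hBdet.mono fun s hs => hs.symm))
  rw [Matrix.det_diagonal] at hz
  obtain ⟨m, -, hm⟩ := Finset.prod_eq_zero_iff.mp hz
  exact ⟨m, hm⟩

open Filter Topology Asymptotics in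
theorem exists_iteratedDeriv_eq_zero_of_det_eq_zero {k : ℕ} {f : ℝ → ℝ} {J : Set ℝ}
    (hJ : IsOpen J) (hJc : Convex ℝ J) (hf : ContDiffOn ℝ k f J) {a : ℝ} (ha : a ∈ J)
    (hdet : ∀ v : Fin (k + 1) → ℝ, (∀ i j, a + v i * v j ∈ J) →
      (Matrix.of fun i j => f (a + v i * v j)).det = 0) :
    ∃ m ≤ k, iteratedDeriv m f a = 0 := by
  have hT := taylor_isLittleO hJc ha hf
  rw [hJ.nhdsWithin_eq ha] at hT
  have hc : Tendsto (fun t : ℝ => a + t) (𝓝 0) (𝓝 a) := by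
    have : ContinuousAt (fun t : ℝ => a + t) 0 := by fun_prop
    simpa using this.tendsto
  have hT := hT.comp_tendsto hc
  obtain ⟨m, hm⟩ := exists_coeff_eq_zero_of_det_eq_zero (k := k) (g := fun t => f (a + t))
    (d := fun m => ((m : ℕ).factorial : ℝ)⁻¹ * iteratedDeriv m f a) (by
      refine (hT.congr_right fun t => by simp).congr_left fun t => ?_
      simp only [Function.comp, taylor_within_apply, add_sub_cancel_left, smul_eq_mul]
      rw [Finset.sum_range]
      congr 1
      refine Finset.sum_congr rfl fun m _ => ?_
      rw [iteratedDerivWithin_of_isOpen hJ ha]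
      ring) (by
      have hev : ∀ i j : Fin (k + 1), ∀ᶠ s in 𝓝[≠] (0 : ℝ),
          a + s * (i : ℝ) * (s * (j : ℝ)) ∈ J := by
        intro i j
        have : ContinuousAt (fun s : ℝ => a + s * (i : ℝ) * (s * (j : ℝ))) 0 := by fun_prop
        have h2 := this.tendsto
        simp only [zero_mul, add_zero] at h2
        exact (h2.mono_left nhdsWithin_le_nhds).eventually (hJ.mem_nhds ha)
      filter_upwards [eventually_all.mpr fun i => eventually_all.mpr (hev i)] with s hs
      rw [← hdet (fun i => s * (i : ℝ)) hs]
      congr 1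
      ext i j
      simp only [Matrix.of_apply]
      ring_nf)
  refine ⟨m, Nat.le_of_lt_succ m.is_lt, ?_⟩
  have : ((m : ℕ).factorial : ℝ)⁻¹ ≠ 0 := by positivity
  simpa [this] using hm

/-- If at each point of an open set one of the first derivatives of `f` vanishes, then so does the
highest of them everywhere. -/
theorem iteratedDeriv_eq_zero_of_forall_exists {k : ℕ} {f : ℝ → ℝ} {J : Set ℝ}
    (hJ : IsOpen J) (hf : ContDiffOn ℝ k f J)
    (h : ∀ a ∈ J, ∃ m ≤ k, iteratedDeriv m f a = 0) {a : ℝ} (ha : a ∈ J) :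
    iteratedDeriv k f a = 0 := by
  by_contra hne
  have hcont : ∀ m ≤ k, ContinuousOn (iteratedDeriv m f) J := fun m hm =>
    (hf.continuousOn_iteratedDerivWithin (by exact_mod_cast hm) hJ.uniqueDiffOn).congr
      fun x hx => (iteratedDerivWithin_of_isOpen hJ hx).symm
  -- Descending from order k, each lower derivative is made nonzero on a smaller open set; at j = k
  -- no order is left to vanish.
  have key : ∀ j ≤ k, ∃ V ⊆ J, IsOpen V ∧ V.Nonempty ∧
      ∀ x ∈ V, ∀ m, k - j ≤ m → m ≤ k → iteratedDeriv m f x ≠ 0 := by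
    intro j
    induction j with
    | zero =>
      intro _
      refine ⟨J ∩ iteratedDeriv k f ⁻¹' {0}ᶜ, Set.inter_subset_left,
        (hcont k le_rfl).isOpen_inter_preimage hJ isOpen_compl_singleton, ⟨a, ha, hne⟩, ?_⟩
      intro x hx m hm hmk
      obtain rfl : m = k := by omega
      exact hx.2
    | succ j ih =>
      intro hj
      obtain ⟨V, hVJ, hV, ⟨b, hb⟩, hVne⟩ := ih (by omega)
      have hc : ContinuousOn (iteratedDeriv (k - (j + 1)) f) V :=
        (hcont _ (by omega)).mono hVJ
      refine ⟨V ∩ iteratedDeriv (k - (j + 1)) f ⁻¹' {0}ᶜ, Set.inter_subset_left.trans hVJ,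
        hc.isOpen_inter_preimage hV isOpen_compl_singleton, ?_, ?_⟩
      · by_contra hemp
        rw [Set.not_nonempty_iff_eq_empty] at hemp
        have hz : ∀ x ∈ V, iteratedDeriv (k - (j + 1)) f x = 0 := by
          intro x hx
          by_contra hx0
          exact (hemp ▸ (show x ∈ V ∩ iteratedDeriv (k - (j + 1)) f ⁻¹' {0}ᶜ from
            ⟨hx, hx0⟩) : x ∈ (∅ : Set ℝ))
        -- A derivative vanishing on all of V would force the next one to vanish at b.
        refine hVne b hb (k - (j + 1) + 1) (by omega) (by omega) ?_
        rw [iteratedDeriv_succ]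
        have : iteratedDeriv (k - (j + 1)) f =ᶠ[nhds b] fun _ => 0 := by
          filter_upwards [hV.mem_nhds hb] with x hx using hz x hx
        rw [this.deriv_eq, deriv_const]
      · intro x hx m hm hmk
        rcases Nat.lt_or_ge m (k - j) with h1 | h1
        · obtain rfl : m = k - (j + 1) := by omega
          exact hx.2
        · exact hVne x hx.1 m h1 hmk
  obtain ⟨V, hVJ, -, ⟨b, hb⟩, hVne⟩ := key k le_rfl
  obtain ⟨m, hm, h0⟩ := h b (hVJ hb)
  exact hVne b hb m (by omega) hm h0

/-! ### Polynomials: integration, rank and positivity -/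

open Polynomial in
theorem Polynomial.exists_derivative_eq (p : ℝ[X]) {k : ℕ} (hp : p.degree < k) :
    ∃ q : ℝ[X], q.degree < (k + 1 : ℕ) ∧ derivative q = p := by
  refine ⟨∑ m ∈ Finset.range k, C (p.coeff m / ((m : ℝ) + 1)) * X ^ (m + 1), ?_, ?_⟩
  · refine (degree_sum_le _ _).trans_lt ?_
    rw [Finset.sup_lt_iff (WithBot.bot_lt_coe _)]
    intro m hm
    refine (degree_C_mul_X_pow_le _ _).trans_lt ?_
    exact_mod_cast Nat.succ_lt_succ (Finset.mem_range.mp hm)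
  · ext m
    rw [coeff_derivative, finsetSum_coeff]
    simp only [coeff_C_mul, coeff_X_pow, add_left_inj, mul_ite, mul_one, mul_zero,
      Finset.sum_ite_eq, Finset.mem_range]
    split_ifs with h
    · have : (m : ℝ) + 1 ≠ 0 := by positivity
      field_simp
    · rw [zero_mul, coeff_eq_zero_of_degree_lt]
      exact hp.trans_le (by exact_mod_cast not_lt.mp h)

open Polynomial in
theorem exists_polynomial_of_iteratedDeriv_eq_zero {k : ℕ} {f : ℝ → ℝ} {J : Set ℝ}
    (hJ : IsOpen J) (hJc : IsPreconnected J) (hf : ContDiffOn ℝ k f J)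
    (h : ∀ a ∈ J, iteratedDeriv k f a = 0) :
    ∃ p : ℝ[X], p.degree < k ∧ ∀ x ∈ J, f x = p.eval x := by
  induction k generalizing f with
  | zero =>
    refine ⟨0, by simp, fun x hx => ?_⟩
    simpa using h x hx
  | succ k ih =>
    have hf' : ContDiffOn ℝ ((k : WithTop ℕ∞) + 1) f J := by exact_mod_cast hf
    rw [contDiffOn_succ_iff_deriv_of_isOpen hJ] at hf'
    obtain ⟨p, hp, hpf⟩ := ih hf'.2.2 fun a ha => by
      rw [← iteratedDeriv_succ']; exact h a ha
    obtain ⟨q, hq, rfl⟩ := p.exists_derivative_eq hp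
    rcases J.eq_empty_or_nonempty with rfl | ⟨b, hb⟩
    · exact ⟨0, by simp, by simp⟩
    refine ⟨q + C (f b - q.eval b), ?_, fun x hx => ?_⟩
    · refine (degree_add_le _ _).trans_lt (max_lt hq (degree_C_le.trans_lt ?_))
      exact_mod_cast Nat.succ_pos k
    · have := hJ.is_const_of_deriv_eq_zero (f := fun y => f y - q.eval y) hJc
        (hf'.1.sub q.differentiable.differentiableOn) (fun y hy => by
          have hd := ((hf'.1 y hy).differentiableAt (hJ.mem_nhds hy)).hasDerivAt.sub
            (q.hasDerivAt y)
          exact hd.deriv.trans (by simp [hpf y hy])) hx hb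
      simp only [eval_add, eval_C]
      linarith

open Polynomial in
theorem Polynomial.matrix_eval_mul_eq (q : ℝ[X]) {k : ℕ} (hq : q.degree < k) {ι : Type*}
    (v : ι → ℝ) :
    (Matrix.of fun i j => q.eval (v i * v j)) =
      (Matrix.of fun i (m : Fin k) => v i ^ (m : ℕ)) *
        Matrix.diagonal (fun m : Fin k => q.coeff m) *
        (Matrix.of fun i (m : Fin k) => v i ^ (m : ℕ)).transpose := by
  ext i j
  have hsum : q.eval (v i * v j) = ∑ m ∈ Finset.range k, q.coeff m * (v i * v j) ^ m := by
    rcases eq_or_ne q 0 with rfl | h0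
    · simp
    · exact eval_eq_sum_range' ((natDegree_lt_iff_degree_lt h0).mpr hq) _
  rw [Matrix.mul_apply, Matrix.of_apply, hsum, Finset.sum_range]
  refine Finset.sum_congr rfl fun m _ => ?_
  rw [Matrix.mul_diagonal, Matrix.transpose_apply, Matrix.of_apply, Matrix.of_apply, mul_pow]
  ring

open Polynomial in
-- Recentring p at a turns a + u_i u_j into u_i u_j without raising the degree.
theorem map_specialMatrix_eq {n k : ℕ} {f : ℝ → ℝ} {I : Set ℝ} {p : ℝ[X]} (hp : p.degree < k)
    (hf : ∀ x ∈ I, f x = p.eval x) {a : ℝ} {u : Fin n → ℝ} (hu : ∀ i j, a + u i * u j ∈ I) :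
    (specialMatrix a u).map f =
      (Matrix.of fun i (m : Fin k) => u i ^ (m : ℕ)) *
        Matrix.diagonal (fun m : Fin k => (taylor a p).coeff m) *
        (Matrix.of fun i (m : Fin k) => u i ^ (m : ℕ)).transpose := by
  rw [← Polynomial.matrix_eval_mul_eq (taylor a p) (by rwa [degree_taylor])]
  ext i j
  rw [Matrix.map_apply, specialMatrix_apply, hf _ (hu i j), Matrix.of_apply, taylor_eval, add_comm]

theorem rank_mul_mul_le_of_fin {n k : ℕ} (V : Matrix (Fin n) (Fin k) ℝ)
    (D : Matrix (Fin k) (Fin k) ℝ) (W : Matrix (Fin k) (Fin n) ℝ) : (V * D * W).rank ≤ k :=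
  (Matrix.rank_mul_le_left _ _).trans ((Matrix.rank_mul_le_left _ _).trans (Matrix.rank_le_width V))

open Polynomial in
theorem map_specialMatrix_mem_symmRankLE {n k : ℕ} {f : ℝ → ℝ} {I : Set ℝ} {p : ℝ[X]}
    (hp : p.degree < k) (hf : ∀ x ∈ I, f x = p.eval x) {a : ℝ} {u : Fin n → ℝ}
    (hu : ∀ i j, a + u i * u j ∈ I) : (specialMatrix a u).map f ∈ symmRankLE n k := by
  rw [map_specialMatrix_eq hp hf hu]
  refine ⟨?_, rank_mul_mul_le_of_fin _ _ _⟩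
  rw [Matrix.IsSymm, Matrix.transpose_mul, Matrix.transpose_mul, Matrix.transpose_transpose,
    Matrix.diagonal_transpose, Matrix.mul_assoc]

open Polynomial in
theorem map_specialMatrix_mem_psdRankLE {n k : ℕ} {f : ℝ → ℝ} {I : Set ℝ} {p : ℝ[X]}
    (hp : p.degree < k) (hp0 : ∀ m, 0 ≤ p.coeff m) (hf : ∀ x ∈ I, f x = p.eval x) {a : ℝ}
    (ha : 0 ≤ a) {u : Fin n → ℝ} (hu : ∀ i j, a + u i * u j ∈ I) :
    (specialMatrix a u).map f ∈ psdRankLE n k := by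
  rw [map_specialMatrix_eq hp hf hu]
  refine ⟨?_, rank_mul_mul_le_of_fin _ _ _⟩
  rw [← Matrix.conjTranspose_eq_transpose_of_trivial]
  refine Matrix.PosSemidef.mul_mul_conjTranspose_same (Matrix.PosSemidef.diagonal fun m => ?_) _
  -- The coefficient is a Hasse derivative of p evaluated at a ≥ 0, and its own coefficients are
  -- binomial multiples of those of p.
  rw [taylor_coeff, eval_eq_sum_range, Pi.zero_apply]
  refine Finset.sum_nonneg fun i _ => mul_nonneg ?_ (pow_nonneg ha i)
  rw [hasseDeriv_coeff]
  exact mul_nonneg (Nat.cast_nonneg _) (hp0 _)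

/-! ### Consequences of the rank bound -/

/-- Padding v with zeros adds only the entry a, which lies in I; so every family of at most n points
can be tested. -/
theorem exists_submatrix_specialMatrix {n : ℕ} {ι : Type*} [Fintype ι]
    (hι : Fintype.card ι ≤ n) {I : Set ℝ} {a : ℝ} (ha : a ∈ I) {v : ι → ℝ}
    (hv : ∀ i j, a + v i * v j ∈ I) :
    ∃ (e : ι → Fin n) (u : Fin n → ℝ), (∀ i j, a + u i * u j ∈ I) ∧
      ∀ f : ℝ → ℝ, (Matrix.of fun i j => f (a + v i * v j)) =
        ((specialMatrix a u).map f).submatrix e e := by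
  obtain ⟨e⟩ : Nonempty (ι ↪ Fin n) :=
    Function.Embedding.nonempty_of_card_le (by simpa using hι)
  refine ⟨e, Function.extend e v (fun _ => 0), fun i j => ?_, fun f => ?_⟩
  · have key : ∀ i, Function.extend e v (fun _ => 0) i = 0 ∨ ∃ l, Function.extend e v (fun _ => 0) i = v l := by
      intro i
      by_cases h : ∃ l, e l = i
      · obtain ⟨l, rfl⟩ := h
        exact .inr ⟨l, e.injective.extend_apply v _ l⟩
      · exact .inl (Function.extend_apply' v _ i h)
    rcases key i with h | ⟨l, h⟩
    · simpa [h] using ha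
    rcases key j with h' | ⟨l', h'⟩
    · simpa [h'] using ha
    rw [h, h']
    exact hv l l'
  · ext i j
    simp [specialMatrix_apply, e.injective.extend_apply]

theorem Matrix.det_eq_zero_of_rank_lt {ι : Type*} [Fintype ι] [DecidableEq ι]
    {A : Matrix ι ι ℝ} (h : A.rank < Fintype.card ι) : A.det = 0 := by
  by_contra h0
  exact h.ne (Matrix.rank_of_isUnit A ((Matrix.isUnit_iff_isUnit_det A).mpr
    (isUnit_iff_ne_zero.mpr h0)))

theorem det_eq_zero_of_forall_rank_le {n k : ℕ} {f : ℝ → ℝ} {I : Set ℝ}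
    (H : ∀ a ∈ I, ∀ u : Fin n → ℝ, (∀ i j, a + u i * u j ∈ I) →
      ((specialMatrix a u).map f).rank ≤ k) {ι : Type*} [Fintype ι] [DecidableEq ι]
    (hk : k < Fintype.card ι) (hn : Fintype.card ι ≤ n) {a : ℝ} (ha : a ∈ I) {v : ι → ℝ}
    (hv : ∀ i j, a + v i * v j ∈ I) : (Matrix.of fun i j => f (a + v i * v j)).det = 0 := by
  obtain ⟨e, u, hu, he⟩ := exists_submatrix_specialMatrix hn ha hv
  refine Matrix.det_eq_zero_of_rank_lt ?_
  rw [he f]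
  exact ((Matrix.rank_submatrix_le _ _ _).trans (H a ha u hu)).trans_lt hk

open Polynomial in
-- The Taylor argument is two-sided, hence the open J inside I; for [0, R) the endpoint is recovered
-- by continuity.
theorem exists_polynomial_of_forall_rank_le {n k : ℕ} (hkn : k < n) {f : ℝ → ℝ} {I J : Set ℝ}
    (hJI : J ⊆ I) (hJ : IsOpen J) (hJc : Convex ℝ J) (hf : ContDiffOn ℝ k f J)
    (H : ∀ a ∈ I, ∀ u : Fin n → ℝ, (∀ i j, a + u i * u j ∈ I) →
      ((specialMatrix a u).map f).rank ≤ k) :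
    ∃ p : ℝ[X], p.degree < k ∧ ∀ x ∈ J, f x = p.eval x := by
  refine exists_polynomial_of_iteratedDeriv_eq_zero hJ hJc.isPreconnected hf fun a ha =>
    iteratedDeriv_eq_zero_of_forall_exists hJ hf (fun b hb =>
      exists_iteratedDeriv_eq_zero_of_det_eq_zero hJ hJc hf hb fun v hv => ?_) ha
  exact det_eq_zero_of_forall_rank_le H (by simp) (by simpa using hkn) (hJI hb)
    fun i j => hJI (hv i j)

theorem isOpen_setOf_coe_lt (R : EReal) : IsOpen {x : ℝ | (x : EReal) < R} :=
  isOpen_Iio.preimage continuous_coe_real_ereal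

theorem isOpen_symmInterval (R : EReal) : IsOpen (symmInterval R) :=
  (isOpen_Ioi.preimage continuous_coe_real_ereal).inter (isOpen_setOf_coe_lt R)

theorem convex_symmInterval (R : EReal) : Convex ℝ (symmInterval R) := by
  refine Set.OrdConnected.convex ⟨fun x hx y hy z hz => ⟨hx.1.trans_le ?_, lt_of_le_of_lt ?_ hy.2⟩⟩
  · exact_mod_cast hz.1
  · exact_mod_cast hz.2

theorem isOpen_rightInterval_inter_Ioi (R : EReal) : IsOpen (rightInterval R ∩ Set.Ioi 0) := by
  have : rightInterval R ∩ Set.Ioi 0 = {x : ℝ | (x : EReal) < R} ∩ Set.Ioi 0 := by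
    ext x
    exact ⟨fun h => ⟨h.1.2, h.2⟩, fun h => ⟨⟨le_of_lt h.2, h.1⟩, h.2⟩⟩
  rw [this]
  exact (isOpen_setOf_coe_lt R).inter isOpen_Ioi

theorem mem_rightInterval_of_le {R : EReal} {x y : ℝ} (hx : 0 ≤ x) (hxy : x ≤ y)
    (hy : y ∈ rightInterval R) : x ∈ rightInterval R :=
  ⟨hx, lt_of_le_of_lt (by exact_mod_cast hxy) hy.2⟩

theorem convex_rightInterval (R : EReal) : Convex ℝ (rightInterval R) :=
  Set.OrdConnected.convex
    ⟨fun _ hx _ hy _ hz => mem_rightInterval_of_le (hx.1.trans hz.1) hz.2 hy⟩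

theorem zero_mem_rightInterval {R : EReal} (hR : 0 < R) : (0 : ℝ) ∈ rightInterval R :=
  ⟨le_rfl, by exact_mod_cast hR⟩

theorem exists_pos_mem_rightInterval {R : EReal} (hR : 0 < R) : ∃ r ∈ rightInterval R, 0 < r := by
  obtain ⟨r, h0, hr⟩ := EReal.lt_iff_exists_real_btwn.mp hR
  have h0 : 0 < r := by exact_mod_cast h0
  exact ⟨r, ⟨h0.le, hr⟩, h0⟩

open Filter Topology Polynomial in
theorem eq_eval_of_continuousWithinAt {R : EReal} (hR : 0 < R) {f : ℝ → ℝ} {p : ℝ[X]}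
    (hf : ContinuousWithinAt f (rightInterval R) 0)
    (h : ∀ x ∈ rightInterval R ∩ Set.Ioi 0, f x = p.eval x) :
    ∀ x ∈ rightInterval R, f x = p.eval x := by
  intro x hx
  rcases hx.1.eq_or_lt with rfl | hx0
  · obtain ⟨r, hr, hr0⟩ := exists_pos_mem_rightInterval hR
    have hmem : ∀ᶠ y in 𝓝[>] (0 : ℝ), y ∈ rightInterval R ∩ Set.Ioi 0 := by
      filter_upwards [Ioo_mem_nhdsGT hr0] with y hy
      exact ⟨mem_rightInterval_of_le hy.1.le hy.2.le hr, hy.1⟩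
    have h1 : Tendsto f (𝓝[>] 0) (𝓝 (f 0)) :=
      hf.tendsto.comp (tendsto_nhdsWithin_iff.mpr
        ⟨tendsto_id.mono_left nhdsWithin_le_nhds, hmem.mono fun y hy => hy.1⟩)
    have h2 : Tendsto f (𝓝[>] 0) (𝓝 (p.eval 0)) :=
      (p.continuous.continuousAt.tendsto.mono_left nhdsWithin_le_nhds).congr'
        (hmem.mono fun y hy => (h y hy).symm)
    exact tendsto_nhds_unique h1 h2
  · exact h x ⟨hx, hx0⟩

open Polynomial in
theorem exists_polynomial_on_rightInterval {n k : ℕ} (hkn : k < n) {R : EReal} (hR : 0 < R)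
    {f : ℝ → ℝ} (hf : ContDiffOn ℝ k f (rightInterval R ∩ Set.Ioi 0))
    (hf0 : ContinuousWithinAt f (rightInterval R) 0)
    (H : ∀ a ∈ rightInterval R, ∀ u : Fin n → ℝ, (∀ i j, a + u i * u j ∈ rightInterval R) →
      ((specialMatrix a u).map f).rank ≤ k) :
    ∃ p : ℝ[X], p.degree < k ∧ ∀ x ∈ rightInterval R, f x = p.eval x := by
  obtain ⟨p, hp, hpf⟩ := exists_polynomial_of_forall_rank_le hkn Set.inter_subset_left
    (isOpen_rightInterval_inter_Ioi R) ((convex_rightInterval R).inter (convex_Ioi 0)) hf H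
  exact ⟨p, hp, eq_eval_of_continuousWithinAt hR hf0 hpf⟩

/-! ### Nonnegative coefficients -/

theorem posSemidef_of_forall_mem_psdRankLE {n k : ℕ} {f : ℝ → ℝ} {I : Set ℝ}
    (H : ∀ a ∈ I, ∀ u : Fin n → ℝ, (∀ i j, a + u i * u j ∈ I) →
      (specialMatrix a u).map f ∈ psdRankLE n k) {ι : Type*} [Fintype ι]
    (hn : Fintype.card ι ≤ n) {a : ℝ} (ha : a ∈ I) {v : ι → ℝ}
    (hv : ∀ i j, a + v i * v j ∈ I) :
    (Matrix.of fun i j => f (a + v i * v j)).PosSemidef := by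
  obtain ⟨e, u, hu, he⟩ := exists_submatrix_specialMatrix hn ha hv
  rw [he f]
  exact (H a ha u hu).1.submatrix e

open Polynomial in
theorem coeff_nonneg_of_forall_mem_psdRankLE {n k : ℕ} (hkn : k < n) {R : EReal} (hR : 0 < R)
    {f : ℝ → ℝ} {p : ℝ[X]} (hp : p.degree < k) (hf : ∀ x ∈ rightInterval R, f x = p.eval x)
    (H : ∀ a ∈ rightInterval R, ∀ u : Fin n → ℝ, (∀ i j, a + u i * u j ∈ rightInterval R) →
      (specialMatrix a u).map f ∈ psdRankLE n k) (m : ℕ) : 0 ≤ p.coeff m := by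
  rcases Nat.lt_or_ge m k with hm | hm
  swap
  · rw [coeff_eq_zero_of_degree_lt (hp.trans_le (by exact_mod_cast hm))]
  obtain ⟨r, hr, hr0⟩ := exists_pos_mem_rightInterval hR
  have hk0 : (0 : ℝ) < k := by exact_mod_cast (Nat.zero_le m).trans_lt hm
  -- These points are distinct and lie in [0, √r], so with a = 0 all products stay in [0, r].
  set v : Fin k → ℝ := fun i => √r * ((i : ℝ) / k) with hvdef
  have hv0 : ∀ i, 0 ≤ v i := fun i => by positivity
  have hv1 : ∀ i, v i ≤ √r := fun i => mul_le_of_le_one_right (Real.sqrt_nonneg r)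
    ((div_le_one hk0).mpr (by exact_mod_cast i.is_lt.le))
  have hmem : ∀ i j, 0 + v i * v j ∈ rightInterval R := by
    intro i j
    refine mem_rightInterval_of_le (by have := hv0 i; have := hv0 j; positivity) ?_ hr
    rw [zero_add, ← Real.mul_self_sqrt hr0.le]
    exact mul_le_mul (hv1 i) (hv1 j) (hv0 j) (Real.sqrt_nonneg r)
  have hpsd := posSemidef_of_forall_mem_psdRankLE H (by simpa using hkn.le)
    (zero_mem_rightInterval hR) hmem
  have hM : (Matrix.of fun i j => f (0 + v i * v j)) = Matrix.vandermonde v *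
      Matrix.diagonal (fun m : Fin k => p.coeff m) * (Matrix.vandermonde v).transpose := by
    have := p.matrix_eval_mul_eq hp v
    rw [show Matrix.vandermonde v = Matrix.of fun i (m : Fin k) => v i ^ (m : ℕ) from rfl, ← this]
    ext i j
    rw [Matrix.of_apply, hf _ (hmem i j), Matrix.of_apply, zero_add]
  have hV : IsUnit (Matrix.vandermonde v) := by
    rw [Matrix.isUnit_iff_isUnit_det, isUnit_iff_ne_zero, Matrix.det_vandermonde_ne_zero_iff]
    intro i j hij
    have h1 : √r ≠ 0 := (Real.sqrt_pos.mpr hr0).ne'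
    have h2 : (i : ℝ) / k = (j : ℝ) / k := mul_left_cancel₀ h1 hij
    exact Fin.ext (by exact_mod_cast (div_left_inj' hk0.ne').mp h2)
  -- Congruence by an invertible Vandermonde matrix reflects positivity to the diagonal of
  -- coefficients.
  rw [hM, ← Matrix.conjTranspose_eq_transpose_of_trivial, ← Matrix.star_eq_conjTranspose,
    Matrix.IsUnit.posSemidef_star_right_conjugate_iff hV, Matrix.posSemidef_diagonal_iff] at hpsd
  exact hpsd ⟨m, hm⟩

/-! ### Automatic continuity -/

theorem monotoneOn_of_posSemidef {R : EReal} {f : ℝ → ℝ}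
    (H : ∀ a ∈ rightInterval R, ∀ v : Fin 2 → ℝ, (∀ i j, a + v i * v j ∈ rightInterval R) →
      (Matrix.of fun i j => f (a + v i * v j)).PosSemidef) :
    MonotoneOn f (rightInterval R) := by
  intro p hp q hq hpq
  have hs : √(q - p) * √(q - p) = q - p := Real.mul_self_sqrt (sub_nonneg.mpr hpq)
  have hpsd := H p hp ![√(q - p), 0] (by
    intro i j
    fin_cases i <;> fin_cases j <;> simp [hs, hp, hq])
  have h := hpsd.dotProduct_mulVec_nonneg ![1, -1]
  simp [Matrix.mulVec, dotProduct, Fin.sum_univ_two, hs] at h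
  linarith

theorem two_mul_le_add_of_posSemidef {R : EReal} {f : ℝ → ℝ}
    (H : ∀ a ∈ rightInterval R, ∀ v : Fin 3 → ℝ, (∀ i j, a + v i * v j ∈ rightInterval R) →
      (Matrix.of fun i j => f (a + v i * v j)).PosSemidef) {a s : ℝ} (hs : 0 ≤ s) (hsa : s ≤ a)
    (has : a + s ∈ rightInterval R) : 2 * f a ≤ f (a + s) + f (a - s) := by
  have hss : √s * √s = s := Real.mul_self_sqrt hs
  have ha : a ∈ rightInterval R := mem_rightInterval_of_le (hs.trans hsa) (by linarith) has
  have ha' : a + -s ∈ rightInterval R := mem_rightInterval_of_le (by linarith) (by linarith) has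
  have hpsd := H a ha ![√s, -√s, 0] (by
    intro i j
    fin_cases i <;> fin_cases j <;> simp [hss, ha, has, ha'])
  have h := hpsd.dotProduct_mulVec_nonneg ![1, 1, -2]
  simp [Matrix.mulVec, dotProduct, Fin.sum_univ_three, hss] at h
  rw [sub_eq_add_neg]
  linarith

/-- Midpoint convexity makes increments over consecutive steps of length h nondecreasing, so the
first is at most the mean. -/
theorem mul_sub_le_of_two_mul_le_add {R : EReal} {f : ℝ → ℝ}
    (hmid : ∀ a s : ℝ, 0 ≤ s → s ≤ a → a + s ∈ rightInterval R →
      2 * f a ≤ f (a + s) + f (a - s)) {x h : ℝ} (hx : 0 ≤ x) (hh : 0 ≤ h) (N : ℕ)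
    (hN : x + N * h ∈ rightInterval R) : N * (f (x + h) - f x) ≤ f (x + N * h) - f x := by
  have step : ∀ j : ℕ, x + ((j : ℝ) + 1) * h ∈ rightInterval R →
      f (x + h) - f x ≤ f (x + ((j : ℝ) + 1) * h) - f (x + j * h) := by
    intro j
    induction j with
    | zero => intro _; simp
    | succ j ih =>
      intro hj
      push_cast at hj ⊢
      have hjh : 0 ≤ (j : ℝ) * h := by positivity
      have h1 := ih (mem_rightInterval_of_le (by positivity) (by nlinarith) hj)
      have h2 := hmid (x + ((j : ℝ) + 1) * h) h hh (by nlinarith)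
        (by convert hj using 1; ring)
      rw [show x + ((j : ℝ) + 1) * h + h = x + ((j : ℝ) + 1 + 1) * h by ring,
        show x + ((j : ℝ) + 1) * h - h = x + j * h by ring] at h2
      linarith
  induction N with
  | zero => simp
  | succ N ih =>
    push_cast at hN ⊢
    have h1 := ih (mem_rightInterval_of_le (by positivity) (by nlinarith) hN)
    have h2 := step N hN
    linarith

theorem continuousOn_of_monotoneOn_of_two_mul_le_add {R : EReal} {f : ℝ → ℝ}
    (hmono : MonotoneOn f (rightInterval R))
    (hmid : ∀ a s : ℝ, 0 ≤ s → s ≤ a → a + s ∈ rightInterval R →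
      2 * f a ≤ f (a + s) + f (a - s)) : ContinuousOn f (rightInterval R) := by
  intro x hx
  obtain ⟨c, hxc, hcR⟩ := EReal.lt_iff_exists_real_btwn.mp hx.2
  have hxc : x < c := by exact_mod_cast hxc
  have hc : c ∈ rightInterval R := ⟨hx.1.trans hxc.le, hcR⟩
  have h0 : (0 : ℝ) ∈ rightInterval R := mem_rightInterval_of_le le_rfl hx.1 hx
  rw [Metric.continuousWithinAt_iff]
  intro ε hε
  obtain ⟨N, hN⟩ := exists_nat_gt ((f c - f 0) / ε)
  have hN0 : (0 : ℝ) < N :=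
    lt_of_le_of_lt (div_nonneg (sub_nonneg.mpr (hmono h0 hc hc.1)) hε.le) hN
  rw [div_lt_iff₀ hε] at hN
  -- From y ≤ x, N steps of length z - y end before c, so N (f z - f y) ≤ f c - f 0 < N ε.
  have key : ∀ y z : ℝ, y ∈ rightInterval R → z ∈ rightInterval R → y ≤ z → y ≤ x →
      z - y < (c - x) / N → |f z - f y| < ε := by
    intro y z hy hz hyz hyx hd
    rw [lt_div_iff₀ hN0] at hd
    have hle : y + N * (z - y) ≤ c := by linarith
    have hmem := mem_rightInterval_of_le (add_nonneg hy.1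
      (mul_nonneg hN0.le (sub_nonneg.mpr hyz))) hle hc
    have h1 := mul_sub_le_of_two_mul_le_add hmid hy.1 (sub_nonneg.mpr hyz) N hmem
    rw [add_sub_cancel] at h1
    have h2 := hmono hmem hc hle
    have h3 := hmono h0 hy hy.1
    rw [abs_of_nonneg (sub_nonneg.mpr (hmono hy hz hyz))]
    have h4 : N * (f z - f y) < N * ε := by linarith
    exact lt_of_mul_lt_mul_left h4 hN0.le
  refine ⟨(c - x) / N, div_pos (sub_pos.mpr hxc) hN0, fun y hy hyd => ?_⟩
  rw [Real.dist_eq] at hyd ⊢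
  rcases le_total x y with h | h
  · exact key x y hx hy h le_rfl ((le_abs_self _).trans_lt hyd)
  · rw [abs_sub_comm] at hyd ⊢
    exact key y x hy hx h h ((le_abs_self _).trans_lt hyd)

/-! ### Smoothness of positive kernels of finite rank -/

open Set in
theorem exists_primitive {f : ℝ → ℝ} {β : ℝ} (hβ : 0 < β) (hf : ContinuousOn f (Ioo 0 β)) :
    ∃ Φ : ℝ → ℝ, ∀ w ∈ Ioo 0 β, HasDerivAt Φ (f w) w := by
  -- The base point is interior because f need not be integrable up to 0 or β.
  refine ⟨fun w => ∫ t in (β / 2)..w, f t, fun w hw => ?_⟩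
  have hsub : uIcc (β / 2) w ⊆ Ioo 0 β :=
    ordConnected_Ioo.uIcc_subset ⟨by linarith, by linarith⟩ hw
  have hw' := isOpen_Ioo.mem_nhds hw
  exact intervalIntegral.integral_hasDerivAt_right (hf.mono hsub).intervalIntegrable
    (hf.stronglyMeasurableAtFilter isOpen_Ioo w hw) (hf.continuousAt hw')

open Set in
theorem ContDiffOn.succ_of_hasDerivAt {f Φ : ℝ → ℝ} {U : Set ℝ} (hU : IsOpen U) {m : ℕ}
    (hf : ContDiffOn ℝ m f U) (hΦ : ∀ w ∈ U, HasDerivAt Φ (f w) w) :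
    ContDiffOn ℝ (m + 1 : ℕ) Φ U := by
  push_cast
  rw [contDiffOn_succ_iff_deriv_of_isOpen hU]
  exact ⟨fun w hw => (hΦ w hw).differentiableAt.differentiableWithinAt, by simp,
    hf.congr fun w hw => (hΦ w hw).deriv⟩

theorem mul_mem_Ioo_sq {b x y : ℝ} (hx : x ∈ Set.Ioo 0 b) (hy : y ∈ Set.Ioo 0 b) :
    x * y ∈ Set.Ioo 0 (b ^ 2) :=
  ⟨mul_pos hx.1 hy.1, by nlinarith [hx.1, hx.2, hy.1, hy.2]⟩

open Set Filter Topology in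
/-- A continuous function `f` for which the kernel `f (x * y)` has finite rank gains one derivative
at a time. -/
theorem contDiffOn_succ_of_separated {f : ℝ → ℝ} {b : ℝ} (hb : 0 < b) {ι : Type*} [Fintype ι]
    [DecidableEq ι] {v : ι → ℝ} (hv : ∀ i, v i ∈ Ioo 0 b) {c : ι → ℝ → ℝ}
    (hdet : (Matrix.of fun i j => f (v i * v j)).det ≠ 0)
    (hsep : ∀ x ∈ Ioo 0 b, ∀ y ∈ Ioo 0 b, f (x * y) = ∑ i, f (x * v i) * c i y) {m : ℕ}
    (hf : ContDiffOn ℝ m f (Ioo 0 (b ^ 2))) : ContDiffOn ℝ (m + 1 : ℕ) f (Ioo 0 (b ^ 2)) := by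
  obtain ⟨Φ, hΦ⟩ := exists_primitive (pow_pos hb 2) hf.continuousOn
  have hΦs := hf.succ_of_hasDerivAt isOpen_Ioo hΦ
  have hder : ∀ x ∈ Ioo 0 b, ∀ y ∈ Ioo 0 b,
      HasDerivAt (fun x => Φ (x * y) / y) (f (x * y)) x := by
    intro x hx y hy
    have h1 := (hΦ _ (mul_mem_Ioo_sq hx hy)).comp x ((hasDerivAt_id x).mul_const y)
    have h2 := h1.div_const y
    simpa [hy.1.ne'] using h2
  -- Entries are averages of x ↦ f(x v_i) over [v_j, v_j + ε]; for small ε the matrix inherits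
  -- invertibility from its limit.
  let A : ℝ → Matrix ι ι ℝ := fun ε => Matrix.of fun j i =>
    ε⁻¹ • (Φ ((v j + ε) * v i) / v i - Φ (v j * v i) / v i)
  have hA : Tendsto A (𝓝[>] 0) (𝓝 (Matrix.of fun i j => f (v i * v j))) :=
    tendsto_pi_nhds.mpr fun j => tendsto_pi_nhds.mpr fun i =>
      (hder (v j) (hv j) (v i) (hv i)).tendsto_slope_zero_right
  have hAdet : ∀ᶠ ε in 𝓝[>] (0 : ℝ), (A ε).det ≠ 0 :=
    (((Continuous.matrix_det continuous_id).tendsto _).comp hA).eventually_ne hdet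
  have hAv : ∀ᶠ ε in 𝓝[>] (0 : ℝ), ∀ j, v j + ε ∈ Ioo 0 b := by
    refine eventually_all.mpr fun j => ?_
    filter_upwards [Ioo_mem_nhdsGT (sub_pos.mpr (hv j).2)] with ε hε
    exact ⟨add_pos (hv j).1 hε.1, by linarith [hε.2]⟩
  obtain ⟨ε, hε, hεv⟩ := (hAdet.and hAv).exists
  -- The same average of x ↦ f(xy), now C^{m+1} in y. Averaging the separation gives T = A c, so
  -- inverting A makes each c_i of class C^{m+1}.
  let T : ι → ℝ → ℝ := fun j y => ε⁻¹ • (Φ ((v j + ε) * y) / y - Φ (v j * y) / y)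
  have hT : ∀ y ∈ Ioo 0 b, (fun j => T j y) = (A ε).mulVec fun i => c i y := by
    intro y hy
    funext j
    have hd : ∀ x ∈ Ioo 0 b, HasDerivAt
        (fun x => Φ (x * y) / y - ∑ i, Φ (x * v i) / v i * c i y) 0 x := by
      intro x hx
      have h1 := (hder x hx y hy).sub
        (HasDerivAt.fun_sum (u := Finset.univ) fun i _ => (hder x hx (v i) (hv i)).mul_const (c i y))
      rw [← hsep x hx y hy, sub_self] at h1
      exact h1
    have hconst := isOpen_Ioo.is_const_of_deriv_eq_zero isPreconnected_Ioo
      (fun x hx => (hd x hx).differentiableAt.differentiableWithinAt)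
      (fun x hx => (hd x hx).deriv) (hεv j) (hv j)
    have h2 : Φ ((v j + ε) * y) / y - Φ (v j * y) / y =
        ∑ i, (Φ ((v j + ε) * v i) / v i - Φ (v j * v i) / v i) * c i y := by
      simp only [sub_mul, Finset.sum_sub_distrib]
      linarith
    simp only [T, A, h2, Matrix.mulVec, dotProduct, Matrix.of_apply, smul_eq_mul, Finset.mul_sum,
      mul_assoc]
  have hc : ∀ y ∈ Ioo 0 b, ∀ i, c i y = ∑ j, (A ε)⁻¹ i j * T j y := by
    intro y hy i
    have h1 : (A ε)⁻¹.mulVec (fun j => T j y) = fun i => c i y := by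
      rw [hT y hy, Matrix.mulVec_mulVec, Matrix.nonsing_inv_mul _ (isUnit_iff_ne_zero.mpr hε),
        Matrix.one_mulVec]
    exact (congrFun h1 i).symm
  have hΦc : ∀ w ∈ Ioo 0 b, ContDiffOn ℝ (m + 1 : ℕ) (fun y => Φ (w * y) / y) (Ioo 0 b) := by
    intro w hw
    exact (hΦs.comp (contDiff_const.mul contDiff_id).contDiffOn
      fun y hy => mul_mem_Ioo_sq hw hy).div contDiffOn_id fun y hy => hy.1.ne'
  have hcs : ∀ i, ContDiffOn ℝ (m + 1 : ℕ) (c i) (Ioo 0 b) := by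
    intro i
    have hTs : ∀ j, ContDiffOn ℝ (m + 1 : ℕ) (T j) (Ioo 0 b) := fun j =>
      ((hΦc _ (hεv j)).sub (hΦc _ (hv j))).const_smul ε⁻¹
    have hsum : ContDiffOn ℝ (m + 1 : ℕ) (fun y => ∑ j, (A ε)⁻¹ i j * T j y) (Ioo 0 b) :=
      ContDiffOn.sum fun j _ => contDiffOn_const.mul (hTs j)
    exact hsum.congr fun y hy => hc y hy i
  intro z hz
  have hsz : 0 < √z := Real.sqrt_pos.mpr hz.1
  have hsb : √z ∈ Ioo 0 b := ⟨hsz, (Real.sqrt_lt' hb).mpr hz.2⟩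
  have hpre : (fun w => w / √z) ⁻¹' Ioo 0 b ∈ 𝓝 z := by
    refine (continuous_id.div_const (√z)).continuousAt.preimage_mem_nhds (isOpen_Ioo.mem_nhds ?_)
    simpa [Real.div_sqrt] using hsb
  -- Writing w = √z · (w/√z) freezes x = √z, so only the c_i depend on w.
  have hloc : ContDiffAt ℝ (m + 1 : ℕ) (fun w => ∑ i, f (√z * v i) * c i (w / √z)) z := by
    refine ContDiffAt.sum fun i _ => contDiffAt_const.mul ?_
    have h1 : ContDiffAt ℝ (m + 1 : ℕ) (c i) (z / √z) :=
      (hcs i).contDiffAt (isOpen_Ioo.mem_nhds (by simpa [Real.div_sqrt] using hsb))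
    exact h1.comp z (contDiffAt_id.div_const _)
  refine (hloc.congr_of_eventuallyEq ?_).contDiffWithinAt
  filter_upwards [hpre] with w hw
  rw [← hsep _ hsb _ hw, mul_div_cancel₀ w hsz.ne']

open Set in
theorem contDiffOn_of_separated {f : ℝ → ℝ} {b : ℝ} (hb : 0 < b) {ι : Type*} [Fintype ι]
    [DecidableEq ι] {v : ι → ℝ} (hv : ∀ i, v i ∈ Ioo 0 b) {c : ι → ℝ → ℝ}
    (hdet : (Matrix.of fun i j => f (v i * v j)).det ≠ 0)
    (hsep : ∀ x ∈ Ioo 0 b, ∀ y ∈ Ioo 0 b, f (x * y) = ∑ i, f (x * v i) * c i y)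
    (hf : ContinuousOn f (Ioo 0 (b ^ 2))) (m : ℕ) : ContDiffOn ℝ m f (Ioo 0 (b ^ 2)) := by
  induction m with
  | zero => exact_mod_cast contDiffOn_zero.mpr hf
  | succ m ih => exact contDiffOn_succ_of_separated hb hv hdet hsep ih

open Set Matrix in
/-- A positive semidefinite kernel `f (x * y)` of bounded rank is a finite sum of separated
terms. -/
theorem exists_separated {k : ℕ} {f : ℝ → ℝ} {b : ℝ}
    (hrank : ∀ v : Fin (k + 1) → ℝ, (∀ i, v i ∈ Ioo 0 b) →
      (Matrix.of fun i j => f (v i * v j)).det = 0)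
    (hpsd : ∀ r ≤ k, ∀ v : Fin r ⊕ Fin 2 → ℝ, (∀ i, v i ∈ Ioo 0 b) →
      (Matrix.of fun i j => f (v i * v j)).PosSemidef) :
    ∃ (r : ℕ) (v : Fin r → ℝ) (c : Fin r → ℝ → ℝ), (∀ i, v i ∈ Ioo 0 b) ∧
      (Matrix.of fun i j => f (v i * v j)).det ≠ 0 ∧
      ∀ x ∈ Ioo 0 b, ∀ y ∈ Ioo 0 b, f (x * y) = ∑ i, f (x * v i) * c i y := by
  classical
  let P : ℕ → Prop := fun r => ∃ v : Fin r → ℝ, (∀ i, v i ∈ Ioo 0 b) ∧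
    (Matrix.of fun i j => f (v i * v j)).det ≠ 0
  have hP0 : P 0 := ⟨Fin.elim0, fun i => i.elim0, by simp⟩
  set r := Nat.findGreatest P k with hr
  have hrk : r ≤ k := Nat.findGreatest_le k
  obtain ⟨v, hv, hM⟩ : P r := Nat.findGreatest_spec (Nat.zero_le k) hP0
  -- For r < k this is maximality; the search stops at k, where the rank bound takes over.
  have hmax : ¬ P (r + 1) := by
    rcases hrk.lt_or_eq with h | h
    · exact Nat.findGreatest_is_greatest (Nat.lt_succ_self r) h
    · rw [h]
      rintro ⟨w, hw, hw0⟩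
      exact hw0 (hrank w hw)
  set M : Matrix (Fin r) (Fin r) ℝ := Matrix.of fun i j => f (v i * v j) with hMdef
  have hMu : IsUnit M := (Matrix.isUnit_iff_isUnit_det M).mpr (isUnit_iff_ne_zero.mpr hM)
  let _ : Invertible M := hMu.invertible
  let B : (l : ℕ) → (Fin l → ℝ) → Matrix (Fin r) (Fin l) ℝ := fun l w =>
    Matrix.of fun i j => f (v i * w j)
  let S : (l : ℕ) → (Fin l → ℝ) → Matrix (Fin l) (Fin l) ℝ := fun l w =>
    (Matrix.of fun i j => f (w i * w j)) - (B l w)ᴴ * M⁻¹ * B l w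
  have hblock : ∀ (l : ℕ) (w : Fin l → ℝ),
      (Matrix.of fun i j => f (Sum.elim v w i * Sum.elim v w j)) =
        Matrix.fromBlocks M (B l w) (B l w)ᴴ (Matrix.of fun i j => f (w i * w j)) := by
    intro l w
    ext (i | i) (j | j) <;> simp [M, B, mul_comm]
  have hmem : ∀ (l : ℕ) (w : Fin l → ℝ), (∀ i, w i ∈ Ioo 0 b) →
      ∀ i, Sum.elim v w i ∈ Ioo 0 b := by
    rintro l w hw (i | i)
    exacts [hv i, hw i]
  -- Bordering M by x multiplies its determinant by this Schur complement; a nonzero value would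
  -- contradict the maximality of r.
  have hdiag : ∀ x ∈ Ioo 0 b, (S 1 fun _ => x) 0 0 = 0 := by
    intro x hx
    by_contra hne
    refine hmax ⟨Sum.elim v (fun _ : Fin 1 => x) ∘ finSumFinEquiv.symm,
      fun i => hmem 1 _ (fun _ => hx) _, ?_⟩
    have h1 := congrArg Matrix.det (hblock 1 fun _ => x)
    rw [Matrix.det_fromBlocks₁₁, Matrix.invOf_eq_nonsing_inv, ← Matrix.det_submatrix_equiv_self
      finSumFinEquiv.symm, Matrix.det_fin_one] at h1
    exact h1.trans_ne (mul_ne_zero hM hne)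
  have hMpd : M.PosDef := by
    have h1 : M.PosSemidef := by
      -- Positivity is assumed only with two extra points in (0, b); repeating some v i supplies
      -- them.
      rcases isEmpty_or_nonempty (Fin r) with h | ⟨⟨i⟩⟩
      · rw [Subsingleton.elim M 0]
        exact Matrix.PosSemidef.zero
      · exact (hpsd r hrk _ (hmem 2 (fun _ => v i) fun _ => hv i)).submatrix Sum.inl
    exact h1.posDef_iff_isUnit.mpr hMu
  refine ⟨r, v, fun i y => ∑ j, M⁻¹ i j * f (v j * y), hv, hM, fun x hx y hy => ?_⟩
  have hxy : ∀ i, ![x, y] i ∈ Ioo 0 b := by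
    intro i
    fin_cases i
    exacts [hx, hy]
  have hS : (S 2 ![x, y]).PosSemidef := by
    have h1 := hpsd r hrk _ (hmem 2 ![x, y] hxy)
    rw [hblock] at h1
    exact (Matrix.PosDef.fromBlocks₁₁ _ _ hMpd).mp h1
  have h00 : S 2 ![x, y] 0 0 = 0 := by
    rw [← hdiag x hx]
    simp [S, B, Matrix.mul_apply]
  have h11 : S 2 ![x, y] 1 1 = 0 := by
    rw [← hdiag y hy]
    simp [S, B, Matrix.mul_apply]
  have hsymm : S 2 ![x, y] 1 0 = S 2 ![x, y] 0 1 := by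
    simpa using hS.isHermitian.apply 0 1
  -- With zero diagonal, the two test vectors bound the off-diagonal entry by 0 from both sides.
  have h1 := hS.dotProduct_mulVec_nonneg ![1, 1]
  have h2 := hS.dotProduct_mulVec_nonneg ![1, -1]
  simp [Matrix.mulVec, dotProduct, Fin.sum_univ_two, h00, h11, hsymm] at h1 h2
  have h01 : S 2 ![x, y] 0 1 = 0 := by linarith
  simp only [S, B, Matrix.sub_apply, Matrix.of_apply, Matrix.mul_assoc, Matrix.mul_apply,
    Matrix.conjTranspose_apply, Matrix.cons_val_zero, Matrix.cons_val_one, star_trivial] at h01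
  rw [sub_eq_zero.mp h01]
  simp only [mul_comm x]

open Set in
theorem contDiffOn_of_forall_mem_psdRankLE {n k : ℕ} (hkn : k + 2 ≤ n) {R : EReal} {f : ℝ → ℝ}
    (hf : ContinuousOn f (rightInterval R))
    (H : ∀ a ∈ rightInterval R, ∀ u : Fin n → ℝ, (∀ i j, a + u i * u j ∈ rightInterval R) →
      (specialMatrix a u).map f ∈ psdRankLE n k) (m : ℕ) :
    ContDiffOn ℝ m f (rightInterval R ∩ Ioi 0) := by
  rintro z ⟨hz, hz0⟩
  obtain ⟨c, hzc, hcR⟩ := EReal.lt_iff_exists_real_btwn.mp hz.2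
  have hzc : z < c := by exact_mod_cast hzc
  have hc0 : 0 < c := lt_trans hz0 hzc
  have hc : c ∈ rightInterval R := ⟨hc0.le, hcR⟩
  have hb : 0 < √c := Real.sqrt_pos.mpr hc0
  have hsq : √c ^ 2 = c := Real.sq_sqrt hc0.le
  have h0 : (0 : ℝ) ∈ rightInterval R := mem_rightInterval_of_le le_rfl hc0.le hc
  have hIoo : ∀ w ∈ Ioo 0 (√c ^ 2), w ∈ rightInterval R := fun w hw =>
    mem_rightInterval_of_le hw.1.le (hw.2.le.trans_eq hsq) hc
  have hmem : ∀ {ι : Type} (v : ι → ℝ), (∀ i, v i ∈ Ioo 0 (√c)) →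
      ∀ i j, 0 + v i * v j ∈ rightInterval R := by
    intro ι v hv i j
    rw [zero_add]
    exact hIoo _ (mul_mem_Ioo_sq (hv i) (hv j))
  -- With z < c < R and b = √c, the products of points of (0, b) stay in (0, c), which contains z.
  -- Sizes k + 1 and r + 2 ≤ k + 2 both fit in n.
  obtain ⟨r, v, d, hv, hdet, hsep⟩ := exists_separated (k := k) (f := f) (b := √c)
    (fun v hv => by
      simpa using det_eq_zero_of_forall_rank_le (fun a ha u hu => (H a ha u hu).2)
        (by simp) (by simp; omega) h0 (hmem v hv))
    (fun r hr v hv => by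
      simpa using posSemidef_of_forall_mem_psdRankLE H (by simp; omega) h0 (hmem v hv))
  have hs := contDiffOn_of_separated hb hv hdet hsep (hf.mono hIoo) m
  exact (hs.contDiffAt (isOpen_Ioo.mem_nhds ⟨hz0, by rwa [hsq]⟩)).contDiffWithinAt

/-! ### The main theorem -/

theorem mainTheorem5 (n k : ℕ) (hk : 1 ≤ k) (hkn : k < n) (R : EReal) (hR : 0 < R)
    (f : ℝ → ℝ) :
    (∀ I : Set ℝ, (I = rightInterval R ∨ I = symmInterval R) →
      ContDiffOn ℝ (k : WithTop ℕ∞) f I →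
      ((∀ a ∈ I, ∀ u : Fin n → ℝ, (∀ i j, a + u i * u j ∈ I) →
          (specialMatrix a u).map f ∈ symmRankLE n k) ↔
        ∃ p : Polynomial ℝ, p.degree < (k : WithBot ℕ) ∧ ∀ x ∈ I, f x = p.eval x)) ∧
    ((ContDiffOn ℝ (k : WithTop ℕ∞) f (rightInterval R) ∨ k + 3 ≤ n) →
      ((∀ a ∈ rightInterval R, ∀ u : Fin n → ℝ, (∀ i j, a + u i * u j ∈ rightInterval R) →
          (specialMatrix a u).map f ∈ psdRankLE n k) ↔
        ∃ p : Polynomial ℝ, p.degree < (k : WithBot ℕ) ∧ (∀ m, 0 ≤ p.coeff m) ∧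
          ∀ x ∈ rightInterval R, f x = p.eval x)) := by
  refine ⟨fun I hI hf => ⟨fun H => ?_, ?_⟩, fun hreg => ⟨fun H => ?_, ?_⟩⟩
  · have Hr := fun a ha u hu => (H a ha u hu).2
    rcases hI with rfl | rfl
    · exact exists_polynomial_on_rightInterval hkn hR (hf.mono Set.inter_subset_left)
        (hf.continuousOn 0 (zero_mem_rightInterval hR)) Hr
    · exact exists_polynomial_of_forall_rank_le hkn subset_rfl (isOpen_symmInterval R)
        (convex_symmInterval R) hf Hr
  · rintro ⟨p, hp, hpf⟩ a _ u hu
    exact map_specialMatrix_mem_symmRankLE hp hpf hu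
  · have hsmooth : ContinuousOn f (rightInterval R) ∧
        ContDiffOn ℝ k f (rightInterval R ∩ Set.Ioi 0) := by
      rcases hreg with hf | hn
      · exact ⟨hf.continuousOn, hf.mono Set.inter_subset_left⟩
      · have hpsd : ∀ l ≤ 3, ∀ a ∈ rightInterval R, ∀ v : Fin l → ℝ,
            (∀ i j, a + v i * v j ∈ rightInterval R) →
            (Matrix.of fun i j => f (a + v i * v j)).PosSemidef := fun l hl a ha v hv =>
          posSemidef_of_forall_mem_psdRankLE H (by simp; omega) ha hv
        have hcont := continuousOn_of_monotoneOn_of_two_mul_le_add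
          (monotoneOn_of_posSemidef (hpsd 2 (by norm_num)))
          fun a s hs hsa has => two_mul_le_add_of_posSemidef (hpsd 3 le_rfl) hs hsa has
        exact ⟨hcont, contDiffOn_of_forall_mem_psdRankLE (by omega) hcont H k⟩
    obtain ⟨p, hp, hpf⟩ := exists_polynomial_on_rightInterval hkn hR hsmooth.2
      (hsmooth.1 0 (zero_mem_rightInterval hR)) fun a ha u hu => (H a ha u hu).2
    exact ⟨p, hp, coeff_nonneg_of_forall_mem_psdRankLE hkn hR hp hpf H, hpf⟩
  · rintro ⟨p, hp, hp0, hpf⟩ a ha u hu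
    exact map_specialMatrix_mem_psdRankLE hp hp0 hpf ha.1 hu
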